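/- Let $k\ge 2$, $\mathcal X=\{1,\dots,k\}$, $h:\mathcal X\to\mathbb R^d$, $\alpha\in\mathbb R^d$, and let $Q$ be a probability mass function on $\mathcal X$ with $Q(x)>0$ for all $x$. Let $E$ be the set of strictly positive probability mass functions $P$ on $\mathcal X$ with $\sum_x P(x)h(x)=\alpha$, and let $P^*\in E$ be the information projection of $Q$, i.e. a minimizer over $P\in E$ of $D(P\|Q)=\sum_x P(x)\log\frac{P(x)}{Q(x)}$; put $p^*_{\min}=\min_x P^*(x)$. Let $\mathsf T^*=\{v\in\mathbb R^k:\sum_x v_x=0,\ \sum_x v_x h(x)=0\}$, assumed $\neq\{0\}$, and let $\lambda_{\min}(H^*)>0$ be the smallest eigenvalue of the operator $H^*=\Pi\,\mathrm{diag}(1/P^*)|_{\mathsf T^*}$ on $\mathsf T^*$, where $\Pi$ is the Euclidean orthogonal projection onto $\mathsf T^*$. Let $X_1,X_2,\dots$ be i.i.d. with law $Q$, let $P_n=\frac1n\sum_{i\le n}\delta_{X_i}$, and let $E_n$ be the set of elements of $E$ that are empirical distributions of $n$ points of $\mathcal X$. For $n$ with $E_n\ne\emptyset$ let $\mu_{n,m}=\mathcal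 L(X_{1:m}\mid P_n\in E_n)$; for $m\le n$ this is the mixture $$\mu_{n,m}(x_{1:m})=\sum_{P\in E_n}\Pr(X_{1:m}=x_{1:m}\mid P_n=P)\,\Pr(P_n=P\mid P_n\in E_n),$$ whose first factor is sampling without replacement from a population of size $n$ with composition $P$. Assume that $P^*$ is in the closure of $\bigcup_n E_n$ (this holds, for instance, whenever $h$ and $\alpha$ have rational coordinates). Then there are constants $C_{\mathrm{geo}},C'_{\mathrm{geo}}>0$ that depend only on $(k,d,p^*_{\min})$ such that for every sequence $m=m_n$ of natural numbers with $m=o\big(\sqrt{n\,\lambda_{\min}(H^*)/\log n}\big)$ as $n\to\infty$, there is a sequence $r_n=o(n^{-1/2})$ such that, for all $n$ with $E_n\neq\emptyset$, $$\|\mu_{n,m}-(P^*)^{\otimes m}\|_{\mathrm{TV}}\le C_{\mathrm{geo}}\,m\sqrt{\frac{\log n}{n\,\lambda_{\min}(H^*)}}+C'_{\mathrm{geo}}\,\frac{m^2}{n\,p^*_{\min}}+r_n ,$$ where $\|\mu-\nu\|_{\mathrm{TV}}=\sup_A|\mu(A)-\nu(A)|$. -/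

import Mathlib

open MeasureTheory ProbabilityTheory Filter Asymptotics

noncomputable section

namespace PredictiveCollapse

/-- The open probability simplex on `k` points. -/
def openSimplex (k : ℕ) : Set (Fin k → ℝ) :=
  {P | (∀ x, 0 < P x) ∧ ∑ x, P x = 1}

/-- The laws in the open simplex under which the feature map `h` has mean `α`. -/
def feasible {k d : ℕ} (h : Fin k → Fin d → ℝ) (α : Fin d → ℝ) : Set (Fin k → ℝ) :=
  {P | P ∈ openSimplex k ∧ ∑ x, P x • h x = α}

/-- The empirical distribution of a sample of size `n` (the zero vector if `n = 0`). -/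
def empirical {k n : ℕ} (x : Fin n → Fin k) : Fin k → ℝ :=
  fun a => ((Finset.univ.filter fun i => x i = a).card : ℝ) / n

/-- The feasible laws that are empirical distributions of samples of size `n`. -/
def feasibleTypes {k d : ℕ} (h : Fin k → Fin d → ℝ) (α : Fin d → ℝ) (n : ℕ) :
    Set (Fin k → ℝ) :=
  {P | P ∈ feasible h α ∧ ∃ x : Fin n → Fin k, empirical x = P}

/-- The Kullback–Leibler divergence of strictly positive laws on `k` points. -/
def kl {k : ℕ} (P Q : Fin k → ℝ) : ℝ :=
  ∑ x, P x * Real.log (P x / Q x)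

/-- `P` is an information projection of `Q` onto the set `E`: it minimizes `kl · Q` over `E`. -/
def IsInfoProjection {k : ℕ} (Q : Fin k → ℝ) (E : Set (Fin k → ℝ)) (P : Fin k → ℝ) : Prop :=
  P ∈ E ∧ ∀ P' ∈ E, kl P Q ≤ kl P' Q

/-- The space of `v` with `∑ x, v x = 0` and `∑ x, v x • h x = 0`. -/
def tangentSpace {k d : ℕ} (h : Fin k → Fin d → ℝ) :
    Submodule ℝ (EuclideanSpace ℝ (Fin k)) where
  carrier := {v | ∑ x, v x = 0 ∧ ∑ x, v x • h x = 0}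
  zero_mem' := by simp
  add_mem' := by
    rintro v w ⟨hv, hv'⟩ ⟨hw, hw'⟩
    constructor
    · simp [Finset.sum_add_distrib, hv, hw]
    · simp [add_smul, Finset.sum_add_distrib, hv', hw']
  smul_mem' := by
    rintro c v ⟨hv, hv'⟩
    constructor
    · simp [← Finset.mul_sum, hv]
    · simp [mul_smul, ← Finset.smul_sum, hv']

/-- The linear map `diag (1 / P)` on Euclidean `k`-space. -/
def diagInv {k : ℕ} (P : Fin k → ℝ) :
    EuclideanSpace ℝ (Fin k) →ₗ[ℝ] EuclideanSpace ℝ (Fin k) :=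
  Matrix.toEuclideanLin (Matrix.diagonal fun x => 1 / P x)

/-- The projected Hessian: `diag (1 / P)` compressed to the tangent space by the
orthogonal projection. In an orthonormal basis `V` of the tangent space this is
the matrix `Vᵀ diag (1 / P) V`. -/
def projHessian {k d : ℕ} (h : Fin k → Fin d → ℝ) (P : Fin k → ℝ) :
    Module.End ℝ (tangentSpace h) :=
  (tangentSpace h).orthogonalProjectionOnto.toLinearMap ∘ₗ diagInv P ∘ₗ (tangentSpace h).subtype

/-- The smallest eigenvalue of an endomorphism of a real vector space (here always a symmetric
endomorphism of a nonzero finite-dimensional space, so that it is attained). -/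
def lambdaMin {V : Type*} [AddCommGroup V] [Module ℝ V] (T : Module.End ℝ V) : ℝ :=
  sInf {μ : ℝ | T.HasEigenvalue μ}

/-- The smallest mass `min_x P x`. -/
def minMass {k : ℕ} (P : Fin k → ℝ) : ℝ :=
  ⨅ x, P x

/-- The measure on `k` points with mass function `P`. -/
def law {k : ℕ} (P : Fin k → ℝ) : Measure (Fin k) :=
  ∑ x, ENNReal.ofReal (P x) • Measure.dirac x

/-- The event that the empirical distribution of the first `n` observations `X 0, …, X (n - 1)`
is feasible. -/
def feasibleEvent {Ω : Type*} {k d : ℕ} (X : ℕ → Ω → Fin k)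
    (h : Fin k → Fin d → ℝ) (α : Fin d → ℝ) (n : ℕ) : Set Ω :=
  {ω | empirical (fun i : Fin n => X i ω) ∈ feasibleTypes h α n}

/-- The law of the first `m` observations, conditionally on the event that the empirical
distribution of the first `n` observations is feasible. For `m ≤ n`, by conditioning further on
the empirical distribution, this is the mixture over the feasible types `P` of sampling `m` times
without replacement from the `n`-point population of type `P`, with weights the conditional
probabilities of the types given feasibility. -/
def predictiveLaw {Ω : Type*} [MeasurableSpace Ω] (Pr : Measure Ω) {k d : ℕ} (X : ℕ → Ω → Fin k)
    (h : Fin k → Fin d → ℝ) (α : Fin d → ℝ) (n m : ℕ) : Measure (Fin m → Fin k) :=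
  (ProbabilityTheory.cond Pr (feasibleEvent X h α n)).map fun ω i => X i ω

/-- The total variation distance `sup_s |μ s - ν s|` of probability measures (`s` measurable). -/
def tvDist {S : Type*} [MeasurableSpace S] (μ ν : Measure S) : ℝ :=
  ⨆ s : {s : Set S // MeasurableSet s}, |μ.real s - ν.real s|

/-- `X 0, X 1, …` are independent with common mass function `Q`. -/
def IsIIDSample {Ω : Type*} [MeasurableSpace Ω] (Pr : Measure Ω) {k : ℕ} (X : ℕ → Ω → Fin k)
    (Q : Fin k → ℝ) : Prop :=
  (∀ i, Measurable (X i)) ∧ iIndepFun X Pr ∧ ∀ i, Pr.map (X i) = law Q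

end PredictiveCollapse

end
open PredictiveCollapse

/-! At the information projection `P` the first order condition makes `log (P / Q)` orthogonal to
the tangent space. Hence on feasible samples the likelihoods of `Q` and `P` differ by a factor that
depends only on `n` (`IsInfoProjection.prod_eq`), and conditioning on feasibility gives the same law
whether one samples from `Q` or from `P`.

Under `P` the method of types applies. Rounding inside the lattice of types yields a feasible type
within `K / n` of `P` (`exists_feasibleType_near`). Its divergence from `P` is `O(1 / n ^ 2)`, so
feasibility has at least polynomially small probability (`exp_neg_kl_le_sum_prod`). Types at
divergence above `δ` have total mass at most `(n + 1) ^ k * exp (-n δ)`, so with `δ = (2 k + 1) log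
n / n` they carry conditional mass `O(1 / n)`, which goes into `r`.

Given its type, the sample is exchangeable: its first `m` entries are draws without replacement,
within `m ^ 2 / n` of the product of the empirical law. For types within `δ`, a Pinsker-type
inequality and subadditivity over factors bound the distance from that product to the product of `P`
by `2 k m √δ`.

The Hessian enters only through `1 ≤ lambdaMin ≤ 1 / minMass P`: the constant `C` may depend on
`minMass P`, so it absorbs the comparison of `log n / n` with `log n / (n * lambdaMin)`. -/

namespace PredictiveCollapse

/-! ### Method of types -/

section Types

variable {k n : ℕ}

/-- The number of occurrences of `a` in the sample `x`. -/
def occurrences (x : Fin n → Fin k) (a : Fin k) : ℕ :=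
  (Finset.univ.filter fun i => x i = a).card

lemma empirical_apply (x : Fin n → Fin k) (a : Fin k) :
    empirical x a = (occurrences x a : ℝ) / n := rfl

lemma prod_comp_eq_prod_pow (P : Fin k → ℝ) (x : Fin n → Fin k) :
    ∏ i, P (x i) = ∏ a, P a ^ occurrences x a := by
  rw [← Finset.prod_fiberwise' Finset.univ x P]
  simp [occurrences]

lemma sum_comp_eq_sum_empirical (f : Fin k → ℝ) (x : Fin n → Fin k) :
    ∑ i, f (x i) = n * ∑ a, empirical x a * f a := by
  rcases Nat.eq_zero_or_pos n with rfl | hn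
  · simp
  rw [← Finset.sum_fiberwise' Finset.univ x f, Finset.mul_sum]
  refine Finset.sum_congr rfl fun a _ => ?_
  have : (n : ℝ) ≠ 0 := by positivity
  simp only [Finset.sum_const, nsmul_eq_mul, empirical_apply, occurrences]
  field_simp

lemma sum_occurrences (x : Fin n → Fin k) : ∑ a, occurrences x a = n := by
  have := Finset.card_eq_sum_card_fiberwise (f := x) (s := Finset.univ) (t := Finset.univ)
    (fun _ _ => by simp)
  simpa [occurrences] using this.symm

lemma occurrences_le (x : Fin n → Fin k) (a : Fin k) : occurrences x a ≤ n := by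
  simpa [occurrences] using Finset.card_filter_le (Finset.univ : Finset (Fin n)) fun i => x i = a

lemma empirical_nonneg (x : Fin n → Fin k) (a : Fin k) : 0 ≤ empirical x a := by
  rw [empirical_apply]; positivity

lemma sum_empirical (hn : 0 < n) (x : Fin n → Fin k) : ∑ a, empirical x a = 1 := by
  have : (n : ℝ) ≠ 0 := by positivity
  simp only [empirical_apply, ← Finset.sum_div]
  rw [← Nat.cast_sum, sum_occurrences, div_self this]

lemma empirical_apply_pos (x : Fin n → Fin k) (i : Fin n) : 0 < empirical x (x i) := by
  have hn : 0 < n := i.pos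
  have : 0 < occurrences x (x i) := Finset.card_pos.2 ⟨i, by simp⟩
  rw [empirical_apply]; positivity

lemma empirical_eq_iff (hn : 0 < n) (x y : Fin n → Fin k) :
    empirical x = empirical y ↔ occurrences x = occurrences y := by
  have : (n : ℝ) ≠ 0 := by positivity
  constructor
  · intro h
    funext a
    have ha := congrFun h a
    rw [empirical_apply, empirical_apply, div_left_inj' this] at ha
    exact_mod_cast ha
  · intro h
    funext a
    rw [empirical_apply, empirical_apply, h]

lemma occurrences_comp_perm (x : Fin n → Fin k) (σ : Equiv.Perm (Fin n)) :
    occurrences (x ∘ σ) = occurrences x := by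
  funext a
  refine Finset.card_bij (fun i _ => σ i) (by simp) (by simp) fun j hj => ⟨σ.symm j, ?_, by simp⟩
  simpa using hj

lemma empirical_comp_perm (x : Fin n → Fin k) (σ : Equiv.Perm (Fin n)) :
    empirical (x ∘ σ) = empirical x := by
  funext a
  rw [empirical_apply, empirical_apply, occurrences_comp_perm]

lemma prod_eq_prod_empirical_mul_exp {R : Fin k → ℝ} (hR : ∀ a, 0 < R a) (x : Fin n → Fin k) :
    ∏ i, R (x i) = (∏ i, empirical x (x i)) * Real.exp (-(n * kl (empirical x) R)) := by
  rw [kl, ← sum_comp_eq_sum_empirical (fun a => Real.log (empirical x a / R a)),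
    ← Finset.sum_neg_distrib, Real.exp_sum, ← Finset.prod_mul_distrib]
  refine Finset.prod_congr rfl fun i _ => ?_
  have h1 := empirical_apply_pos x i
  have h2 := hR (x i)
  rw [Real.exp_neg, Real.exp_log (by positivity)]
  field_simp

lemma sum_prod_eq_one {m : ℕ} {P : Fin k → ℝ} (hP : ∑ a, P a = 1) :
    ∑ y : Fin m → Fin k, ∏ i, P (y i) = 1 := by
  rw [← Fintype.sum_pow, hP, one_pow]

lemma card_image_empirical_le :
    (Finset.univ.image (empirical : (Fin n → Fin k) → Fin k → ℝ)).card ≤ (n + 1) ^ k := by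
  have hsub : Finset.univ.image (empirical : (Fin n → Fin k) → Fin k → ℝ) ⊆
      Finset.univ.image fun (c : Fin k → Fin (n + 1)) a => ((c a : ℕ) : ℝ) / n := by
    intro P hP
    obtain ⟨x, -, rfl⟩ := Finset.mem_image.1 hP
    exact Finset.mem_image.2
      ⟨fun a => ⟨occurrences x a, Nat.lt_succ_of_le (occurrences_le x a)⟩, by simp, rfl⟩
  refine (Finset.card_le_card hsub).trans (Finset.card_image_le.trans ?_)
  simp

/-- The maximum-likelihood masses of all samples of size `n` add up to a polynomial in `n`. -/
lemma sum_prod_empirical_le (hn : 0 < n) :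
    ∑ x : Fin n → Fin k, ∏ i, empirical x (x i) ≤ ((n : ℝ) + 1) ^ k := by
  classical
  set S := Finset.univ.image (empirical : (Fin n → Fin k) → Fin k → ℝ)
  have hS : ∀ P ∈ S, (∀ a, 0 ≤ P a) ∧ ∑ a, P a = 1 := by
    intro P hP
    obtain ⟨x, -, rfl⟩ := Finset.mem_image.1 hP
    exact ⟨empirical_nonneg x, sum_empirical hn x⟩
  calc ∑ x : Fin n → Fin k, ∏ i, empirical x (x i)
      ≤ ∑ x : Fin n → Fin k, ∑ P ∈ S, ∏ i, P (x i) := by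
        refine Finset.sum_le_sum fun x _ => ?_
        exact Finset.single_le_sum (f := fun P : Fin k → ℝ => ∏ i, P (x i))
          (fun P hP => Finset.prod_nonneg fun i _ => (hS P hP).1 _)
          (Finset.mem_image_of_mem _ (Finset.mem_univ x))
    _ = ∑ P ∈ S, 1 := by
        rw [Finset.sum_comm]
        exact Finset.sum_congr rfl fun P hP => sum_prod_eq_one (hS P hP).2
    _ ≤ ((n : ℝ) + 1) ^ k := by
        rw [Finset.sum_const, nsmul_eq_mul, mul_one]
        exact_mod_cast card_image_empirical_le

/-- The method of types bound for samples whose type is at divergence more than `δ`. -/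
lemma sum_prod_of_lt_kl_le (hn : 0 < n) {R : Fin k → ℝ} (hR : ∀ a, 0 < R a) (δ : ℝ) :
    ∑ x : Fin n → Fin k with δ < kl (empirical x) R, ∏ i, R (x i) ≤
      ((n : ℝ) + 1) ^ k * Real.exp (-(n * δ)) := by
  have hnn : ∀ x : Fin n → Fin k, 0 ≤ ∏ i, empirical x (x i) := fun x =>
    Finset.prod_nonneg fun i _ => empirical_nonneg _ _
  calc ∑ x : Fin n → Fin k with δ < kl (empirical x) R, ∏ i, R (x i)
      ≤ ∑ x : Fin n → Fin k with δ < kl (empirical x) R,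
          (∏ i, empirical x (x i)) * Real.exp (-(n * δ)) := by
        refine Finset.sum_le_sum fun x hx => ?_
        rw [prod_eq_prod_empirical_mul_exp hR]
        refine mul_le_mul_of_nonneg_left (Real.exp_le_exp.2 ?_) (hnn x)
        have := (Finset.mem_filter.1 hx).2
        gcongr
    _ ≤ ∑ x : Fin n → Fin k, (∏ i, empirical x (x i)) * Real.exp (-(n * δ)) :=
        Finset.sum_le_sum_of_subset_of_nonneg (Finset.filter_subset _ _)
          fun x _ _ => mul_nonneg (hnn x) (Real.exp_pos _).le
    _ ≤ _ := by
        rw [← Finset.sum_mul]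
        gcongr
        exact sum_prod_empirical_le hn

/-- A lower bound for the number of samples with the same type as `x`. -/
lemma factorial_le_card_mul_prod_factorial (x : Fin n → Fin k) :
    n.factorial ≤
      (Finset.univ.filter fun y : Fin n → Fin k => occurrences y = occurrences x).card *
        ∏ a, (occurrences x a).factorial := by
  classical
  have hstab : (Finset.univ.filter fun σ : Equiv.Perm (Fin n) => x ∘ σ = x).card =
      ∏ a, (occurrences x a).factorial := by
    rw [← Fintype.card_subtype, DomMulAct.stabilizer_card]
    refine Finset.prod_congr rfl fun a _ => ?_
    rw [Fintype.card_subtype, occurrences]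
  have hcard : n.factorial = (Finset.univ : Finset (Equiv.Perm (Fin n))).card := by
    rw [Finset.card_univ, Fintype.card_perm, Fintype.card_fin]
  rw [hcard, ← hstab, mul_comm]
  -- The fibres of `σ ↦ x ∘ σ` are empty or cosets of the stabilizer of `x`; transitivity on the
  -- type class is not needed for this inequality.
  refine Finset.card_le_mul_card_image_of_maps_to (f := fun σ : Equiv.Perm (Fin n) => x ∘ σ)
    (fun σ _ => by simp [occurrences_comp_perm]) _ fun y _ => ?_
  rcases (Finset.univ.filter fun σ : Equiv.Perm (Fin n) => x ∘ σ = y).eq_empty_or_nonempty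
    with h | ⟨τ, hτ⟩
  · rw [h]; simp
  · have hτ' : x ∘ τ = y := (Finset.mem_filter.1 hτ).2
    refine Finset.card_le_card_of_injOn (fun σ => σ * τ⁻¹) (fun σ hσ => ?_)
      fun σ _ σ' _ h => mul_right_cancel h
    have hσ' : x ∘ σ = x ∘ τ := by rw [hτ']; simpa using hσ
    simp only [Finset.coe_filter, Finset.mem_univ, true_and, Set.mem_ofPred_eq]
    funext i
    simpa using congrFun hσ' (τ⁻¹ i)

/-- Stirling's sequence decreases from its value `e / √2` at `c = 1`; the resulting `√c` is then
weakened to `c`. -/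
lemma factorial_le_exp_mul {c : ℕ} (hc : 0 < c) :
    (c.factorial : ℝ) ≤ Real.exp 1 * c * (c / Real.exp 1) ^ c := by
  obtain ⟨c, rfl⟩ : ∃ j, c = j + 1 := ⟨c - 1, by omega⟩
  have h := Stirling.stirlingSeq'_antitone (Nat.zero_le c)
  simp only [Function.comp, Nat.succ_eq_add_one, zero_add, Stirling.stirlingSeq_one] at h
  rw [Stirling.stirlingSeq, div_le_iff₀ (by positivity)] at h
  refine h.trans ?_
  have h1 : (1 : ℝ) ≤ ((c + 1 : ℕ) : ℝ) := by exact_mod_cast Nat.le_add_left 1 c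
  have h2 : √((c + 1 : ℕ) : ℝ) ≤ ((c + 1 : ℕ) : ℝ) := by
    rw [Real.sqrt_le_left (by positivity)]
    nlinarith
  rw [Real.sqrt_mul (by norm_num), ← mul_assoc]
  have h3 : Real.exp 1 / √2 * (√2 * √((c + 1 : ℕ) : ℝ)) = Real.exp 1 * √((c + 1 : ℕ) : ℝ) := by
    have : √(2 : ℝ) ≠ 0 := by positivity
    field_simp
  rw [h3]
  gcongr

/-- Combines `n! ≥ (n / e) ^ n`, read off the exponential series, with the Stirling upper bound for
each count. The powers of `e` cancel because the counts add up to `n`. Counts must be positive since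
the Stirling bound fails at zero. -/
lemma pow_self_le_card_mul (x : Fin n → Fin k) (hx : ∀ a, 0 < occurrences x a) :
    (n : ℝ) ^ n ≤
      ((Finset.univ.filter fun y : Fin n → Fin k => occurrences y = occurrences x).card : ℝ) *
        ((Real.exp 1 * n) ^ k * ∏ a, (occurrences x a : ℝ) ^ occurrences x a) := by
  have h1 : ((n.factorial : ℕ) : ℝ) ≤ _ := Nat.cast_le.2 (factorial_le_card_mul_prod_factorial x)
  have h2 : (n : ℝ) ^ n / n.factorial ≤ Real.exp n :=
    Real.pow_div_factorial_le_exp _ (by positivity) n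
  have h3 : ∏ a, ((occurrences x a).factorial : ℝ) ≤
      ∏ a, (Real.exp 1 * n * (occurrences x a / Real.exp 1) ^ occurrences x a) := by
    refine Finset.prod_le_prod (fun _ _ => by positivity) fun a _ => ?_
    refine (factorial_le_exp_mul (hx a)).trans ?_
    have : (occurrences x a : ℝ) ≤ n := by exact_mod_cast occurrences_le x a
    gcongr
  have h4 : ∏ a, (Real.exp 1 * n * (occurrences x a / Real.exp 1) ^ occurrences x a) =
      (Real.exp 1 * n) ^ k * (∏ a, (occurrences x a : ℝ) ^ occurrences x a) / Real.exp n := by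
    rw [Finset.prod_mul_distrib, Finset.prod_const, Finset.card_univ, Fintype.card_fin]
    simp_rw [div_pow]
    rw [Finset.prod_div_distrib, Finset.prod_pow_eq_pow_sum, sum_occurrences,
      ← Real.exp_nat_mul, mul_one, mul_div_assoc]
  rw [h4] at h3
  push_cast at h1
  rw [div_le_iff₀ (by positivity)] at h2
  refine h2.trans ((mul_le_mul_of_nonneg_left
    (h1.trans (mul_le_mul_of_nonneg_left h3 (by positivity))) (by positivity)).trans_eq ?_)
  have := Real.exp_pos (n : ℝ)
  field_simp

/-- The method of types lower bound for the mass of a type class. -/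
lemma exp_neg_kl_le_sum_prod (hn : 0 < n) {R : Fin k → ℝ} (hR : ∀ a, 0 < R a)
    (x : Fin n → Fin k) (hx : ∀ a, 0 < empirical x a) :
    Real.exp (-(n * kl (empirical x) R)) ≤
      (Real.exp 1 * n) ^ k *
        ∑ y : Fin n → Fin k with empirical y = empirical x, ∏ i, R (y i) := by
  have hn' : (0 : ℝ) < n := by exact_mod_cast hn
  have hocc : ∀ a, 0 < occurrences x a := by
    intro a
    by_contra h
    have := hx a
    rw [empirical_apply, Nat.eq_zero_of_not_pos h] at this
    simp at this
  have hsum : ∑ y : Fin n → Fin k with empirical y = empirical x, ∏ i, R (y i) =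
      ((Finset.univ.filter fun y : Fin n → Fin k => occurrences y = occurrences x).card : ℝ) *
        ∏ i, R (x i) := by
    simp_rw [empirical_eq_iff hn]
    rw [← nsmul_eq_mul, ← Finset.sum_const]
    refine Finset.sum_congr rfl fun y hy => ?_
    rw [prod_comp_eq_prod_pow, prod_comp_eq_prod_pow, (Finset.mem_filter.1 hy).2]
  have hE : ∏ i, empirical x (x i) = (∏ a, (occurrences x a : ℝ) ^ occurrences x a) / n ^ n := by
    rw [prod_comp_eq_prod_pow]
    simp_rw [empirical_apply, div_pow]
    rw [Finset.prod_div_distrib, Finset.prod_pow_eq_pow_sum, sum_occurrences]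
  rw [hsum, prod_eq_prod_empirical_mul_exp hR, hE]
  have h := pow_self_le_card_mul x hocc
  set c := ((Finset.univ.filter fun y : Fin n → Fin k => occurrences y = occurrences x).card : ℝ)
  set A := ∏ a, (occurrences x a : ℝ) ^ occurrences x a
  set e := Real.exp (-(n * kl (empirical x) R))
  have he : 0 < e := Real.exp_pos _
  have : (Real.exp 1 * n) ^ k * (c * (A / n ^ n * e)) =
      (c * ((Real.exp 1 * n) ^ k * A)) / n ^ n * e := by ring
  rw [this]
  refine le_mul_of_one_le_left he.le ?_
  rw [one_le_div (by positivity)]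
  exact h

end Types

/-! ### Divergence against Euclidean and total variation distances -/

section Divergence

variable {k : ℕ} {P R : Fin k → ℝ}

lemma openSimplex_le_one (hP : P ∈ openSimplex k) (a : Fin k) : P a ≤ 1 := by
  rw [← hP.2]
  exact Finset.single_le_sum (fun b _ => (hP.1 b).le) (Finset.mem_univ a)

/-- From `log t ≤ t - 1`; the linear remainders cancel because both laws have mass one. -/
lemma kl_le_sum_sq_div (hP : P ∈ openSimplex k) (hR : R ∈ openSimplex k) :
    kl P R ≤ ∑ a, (P a - R a) ^ 2 / R a := by
  have h : ∀ a, P a * Real.log (P a / R a) ≤ (P a - R a) ^ 2 / R a + (P a - R a) := by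
    intro a
    have h1 := hP.1 a
    have h2 := hR.1 a
    calc P a * Real.log (P a / R a) ≤ P a * (P a / R a - 1) := by
          gcongr
          exact Real.log_le_sub_one_of_pos (by positivity)
      _ = _ := by field_simp; ring
  refine (Finset.sum_le_sum fun a _ => h a).trans_eq ?_
  rw [Finset.sum_add_distrib, Finset.sum_sub_distrib, hP.2, hR.2]
  ring

/-- Applying `log t ≤ t - 1` at `t = √r / √p` bounds the bracket below by `(√p - √r) ^ 2`.
Multiplying this by `(√p + √r) ^ 2 ≤ 4` recovers `(p - r) ^ 2`. -/
lemma sq_sub_le_mul_log {p r : ℝ} (hp : 0 < p) (hr : 0 < r) (hp1 : p ≤ 1) (hr1 : r ≤ 1) :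
    (p - r) ^ 2 ≤ 4 * (p * Real.log (p / r) - p + r) := by
  have hsp : 0 < √p := Real.sqrt_pos.2 hp
  have hsr : 0 < √r := Real.sqrt_pos.2 hr
  have hp2 : √p ^ 2 = p := Real.sq_sqrt hp.le
  have hr2 : √r ^ 2 = r := Real.sq_sqrt hr.le
  have hsp1 : √p ≤ 1 := Real.sqrt_le_one.2 hp1
  have hsr1 : √r ≤ 1 := Real.sqrt_le_one.2 hr1
  set u := √p
  set v := √r
  have hlog : Real.log (p / r) = -(2 * Real.log (v / u)) := by
    rw [← hp2, ← hr2, ← div_pow, Real.log_pow, ← inv_div v u, Real.log_inv]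
    push_cast
    ring
  have h1 : Real.log (v / u) ≤ v / u - 1 := Real.log_le_sub_one_of_pos (by positivity)
  have h2 : p * Real.log (v / u) ≤ p * (v / u - 1) := by gcongr
  have h3 : p * (v / u - 1) = u * v - p := by rw [← hp2]; field_simp
  have h4 : (u - v) ^ 2 ≤ p * Real.log (p / r) - p + r := by
    rw [hlog]
    nlinarith
  have h5 : (p - r) ^ 2 = (u - v) ^ 2 * (u + v) ^ 2 := by rw [← hp2, ← hr2]; ring
  have h6 : (u + v) ^ 2 ≤ 4 := by nlinarith
  rw [h5]
  nlinarith [mul_le_mul_of_nonneg_left h6 (sq_nonneg (u - v))]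

/-- A weak Pinsker inequality: the correction `- P b + R b` makes each term nonnegative and sums to
zero. -/
lemma sq_sub_le_kl (hP : P ∈ openSimplex k) (hR : R ∈ openSimplex k) (a : Fin k) :
    (P a - R a) ^ 2 ≤ 4 * kl P R := by
  have hterm : ∀ b, (P b - R b) ^ 2 ≤ 4 * (P b * Real.log (P b / R b) - P b + R b) := fun b =>
    sq_sub_le_mul_log (hP.1 b) (hR.1 b) (openSimplex_le_one hP b) (openSimplex_le_one hR b)
  calc (P a - R a) ^ 2 ≤ ∑ b, (P b - R b) ^ 2 :=
        Finset.single_le_sum (f := fun b => (P b - R b) ^ 2) (fun b _ => sq_nonneg _)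
          (Finset.mem_univ a)
    _ ≤ ∑ b, 4 * (P b * Real.log (P b / R b) - P b + R b) :=
        Finset.sum_le_sum fun b _ => hterm b
    _ = 4 * kl P R := by
        rw [← Finset.mul_sum, Finset.sum_add_distrib, Finset.sum_sub_distrib, hP.2, hR.2, kl]
        ring

lemma sum_abs_sub_le_sqrt_kl (hP : P ∈ openSimplex k) (hR : R ∈ openSimplex k) :
    ∑ a, |P a - R a| ≤ 2 * k * √(kl P R) := by
  have h : ∀ a, |P a - R a| ≤ 2 * √(kl P R) := by
    intro a
    have h2 : (2 : ℝ) = √4 := by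
      rw [show (4 : ℝ) = 2 ^ 2 by norm_num, Real.sqrt_sq (by norm_num)]
    rw [h2, ← Real.sqrt_mul (by norm_num)]
    exact Real.abs_le_sqrt (sq_sub_le_kl hP hR a)
  refine (Finset.sum_le_sum fun a _ => h a).trans_eq ?_
  simp
  ring

/-- The total variation norm is subadditive under tensor powers. -/
lemma sum_abs_prod_sub_prod_le (hP : ∀ a, 0 ≤ P a) (hP1 : ∑ a, P a = 1)
    (hR : ∀ a, 0 ≤ R a) (hR1 : ∑ a, R a = 1) (m : ℕ) :
    ∑ y : Fin m → Fin k, |∏ i, P (y i) - ∏ i, R (y i)| ≤ m * ∑ a, |P a - R a| := by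
  induction m with
  | zero => simp
  | succ m ih =>
    rw [← (Fin.consEquiv fun _ => Fin k).sum_comp, Fintype.sum_prod_type]
    simp only [Fin.consEquiv_apply, Fin.prod_univ_succ, Fin.cons_zero, Fin.cons_succ]
    have hterm : ∀ (a : Fin k) (y : Fin m → Fin k),
        |P a * ∏ i, P (y i) - R a * ∏ i, R (y i)| ≤
          P a * |∏ i, P (y i) - ∏ i, R (y i)| + |P a - R a| * ∏ i, R (y i) := by
      intro a y
      have hnn : 0 ≤ ∏ i, R (y i) := Finset.prod_nonneg fun i _ => hR _
      calc |P a * ∏ i, P (y i) - R a * ∏ i, R (y i)|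
          = |P a * (∏ i, P (y i) - ∏ i, R (y i)) + (P a - R a) * ∏ i, R (y i)| := by
            congr 1; ring
        _ ≤ _ := by
            refine (abs_add_le _ _).trans_eq ?_
            rw [abs_mul, abs_mul, abs_of_nonneg (hP a), abs_of_nonneg hnn]
    calc _ ≤ ∑ a, ∑ y : Fin m → Fin k,
          (P a * |∏ i, P (y i) - ∏ i, R (y i)| + |P a - R a| * ∏ i, R (y i)) :=
          Finset.sum_le_sum fun a _ => Finset.sum_le_sum fun y _ => hterm a y
      _ = (∑ y : Fin m → Fin k, |∏ i, P (y i) - ∏ i, R (y i)|) + ∑ a, |P a - R a| := by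
          simp_rw [Finset.sum_add_distrib, ← Finset.mul_sum, sum_prod_eq_one hR1, mul_one]
          rw [← Finset.sum_mul, hP1, one_mul]
      _ ≤ _ := by
          push_cast
          linarith

end Divergence

/-! ### Exchangeability and sampling without replacement -/

section Exchangeable

variable {k n m : ℕ}

/-- The mass of the finite set `s` under the `m`-fold product of `P`. -/
def productMass (P : Fin k → ℝ) (s : Finset (Fin m → Fin k)) : ℝ :=
  ∑ y ∈ s, ∏ i, P (y i)

lemma abs_productMass_sub_le {P R : Fin k → ℝ} (hP : ∀ a, 0 ≤ P a) (hP1 : ∑ a, P a = 1)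
    (hR : ∀ a, 0 ≤ R a) (hR1 : ∑ a, R a = 1) (s : Finset (Fin m → Fin k)) :
    |productMass P s - productMass R s| ≤ m * ∑ a, |P a - R a| := by
  refine le_trans ?_ (sum_abs_prod_sub_prod_le hP hP1 hR hR1 m)
  rw [productMass, productMass, ← Finset.sum_sub_distrib]
  exact (Finset.abs_sum_le_sum_abs _ _).trans
    (Finset.sum_le_sum_of_subset_of_nonneg (Finset.subset_univ _) fun _ _ _ => abs_nonneg _)

lemma productMass_nonneg {P : Fin k → ℝ} (hP : ∀ a, 0 ≤ P a) (s : Finset (Fin m → Fin k)) :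
    0 ≤ productMass P s :=
  Finset.sum_nonneg fun _ _ => Finset.prod_nonneg fun _ _ => hP _

lemma productMass_le_one {P : Fin k → ℝ} (hP : ∀ a, 0 ≤ P a) (hP1 : ∑ a, P a = 1)
    (s : Finset (Fin m → Fin k)) : productMass P s ≤ 1 := by
  rw [← sum_prod_eq_one (m := m) hP1]
  exact Finset.sum_le_sum_of_subset_of_nonneg (Finset.subset_univ _)
    fun _ _ _ => Finset.prod_nonneg fun _ _ => hP _

/-- Sampling with replacement from the sample `x` is the product of its empirical distribution. -/
lemma productMass_empirical (x : Fin n → Fin k) (s : Finset (Fin m → Fin k)) :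
    productMass (empirical x) s =
      ((Finset.univ.filter fun j : Fin m → Fin n => x ∘ j ∈ s).card : ℝ) / n ^ m := by
  have h : ∀ y : Fin m → Fin k, ∏ i, empirical x (y i) =
      ((Finset.univ.filter fun j : Fin m → Fin n => x ∘ j = y).card : ℝ) / n ^ m := by
    intro y
    have hset : (Finset.univ.filter fun j : Fin m → Fin n => x ∘ j = y) =
        Fintype.piFinset fun i => Finset.univ.filter fun l => x l = y i := by
      ext j
      simp [funext_iff]
    rw [hset, Fintype.card_piFinset]
    simp [empirical, Finset.prod_div_distrib]
  rw [productMass, Finset.sum_congr rfl fun y _ => h y, ← Finset.sum_div, ← Nat.cast_sum]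
  congr 2
  rw [Finset.card_eq_sum_card_fiberwise (f := fun j : Fin m → Fin n => x ∘ j) (t := s)
    (fun j hj => by simpa using hj)]
  refine Finset.sum_congr rfl fun y hy => ?_
  congr 1
  ext j
  simp only [Finset.mem_filter, Finset.mem_univ, true_and]
  constructor
  · rintro rfl; exact ⟨hy, rfl⟩
  · exact fun h => h.2

/-- A birthday bound: there are at least `(n - m) ^ m` injections, and Bernoulli's inequality
applies to `(1 - m / n) ^ m`. -/
lemma one_sub_le_card_injective_div (hn : 0 < n) (hmn : m ≤ n) :
    1 - (m : ℝ) ^ 2 / n ≤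
      ((Finset.univ.filter fun j : Fin m → Fin n => Function.Injective j).card : ℝ) / n ^ m := by
  have hn' : (0 : ℝ) < n := by exact_mod_cast hn
  have hcard : (Finset.univ.filter fun j : Fin m → Fin n => Function.Injective j).card =
      n.descFactorial m := by
    rw [← Fintype.card_subtype, Fintype.card_congr (Equiv.subtypeInjectiveEquivEmbedding _ _),
      Fintype.card_embedding_eq, Fintype.card_fin, Fintype.card_fin]
  have h1 : ((n - m : ℝ)) ^ m ≤ (n.descFactorial m : ℝ) := by
    have : (((n + 1 - m) ^ m : ℕ) : ℝ) ≤ n.descFactorial m :=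
      Nat.cast_le.2 (n.pow_sub_le_descFactorial m)
    refine le_trans ?_ this
    rw [Nat.cast_pow, Nat.cast_sub (by omega)]
    have hm : (m : ℝ) ≤ n := by exact_mod_cast hmn
    push_cast
    gcongr
    linarith
  have h2 := one_add_mul_le_pow (a := -(m / n : ℝ)) (by
    have : (m : ℝ) / n ≤ 1 := by rw [div_le_one hn']; exact_mod_cast hmn
    linarith) m
  rw [hcard, le_div_iff₀ (by positivity)]
  refine le_trans ?_ h1
  have h3 : ((n : ℝ) - m) ^ m = (1 + -(m / n : ℝ)) ^ m * n ^ m := by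
    rw [← mul_pow]
    congr 1
    field_simp
    ring
  rw [h3]
  gcongr
  refine le_trans (le_of_eq ?_) h2
  ring

/-- Conditioning a uniform law on `q` moves no probability by more than the mass of the complement
of `q`. With `q` injectivity, this compares sampling without and with replacement. -/
lemma abs_card_div_sub_card_div_le {ι : Type*} [Fintype ι] (p q : ι → Prop)
    [DecidablePred p] [DecidablePred q] (hq : ∃ i, q i) :
    |((Finset.univ.filter fun i => q i ∧ p i).card : ℝ) / (Finset.univ.filter q).card -
        ((Finset.univ.filter p).card : ℝ) / Fintype.card ι| ≤
      1 - ((Finset.univ.filter q).card : ℝ) / Fintype.card ι := by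
  have hQ : (0 : ℝ) < (Finset.univ.filter q).card := by
    obtain ⟨i, hi⟩ := hq
    exact_mod_cast Finset.card_pos.2 ⟨i, by simpa using hi⟩
  have hN : ((Finset.univ.filter q).card : ℝ) + (Finset.univ.filter fun i => ¬ q i).card =
      Fintype.card ι := by
    exact_mod_cast Finset.card_filter_add_card_filter_not (s := Finset.univ) q
  have hA : ((Finset.univ.filter p).card : ℝ) = (Finset.univ.filter fun i => q i ∧ p i).card +
      (Finset.univ.filter fun i => ¬ q i ∧ p i).card := by
    have := Finset.card_filter_add_card_filter_not (s := Finset.univ.filter p) q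
    rw [Finset.filter_filter, Finset.filter_filter] at this
    simp_rw [and_comm (a := q _), and_comm (a := ¬ q _)]
    exact_mod_cast this.symm
  have h1 : ((Finset.univ.filter fun i => q i ∧ p i).card : ℝ) ≤ (Finset.univ.filter q).card := by
    exact_mod_cast Finset.card_le_card fun i => by simp +contextual
  have h2 : ((Finset.univ.filter fun i => ¬ q i ∧ p i).card : ℝ) ≤
      (Finset.univ.filter fun i => ¬ q i).card := by
    exact_mod_cast Finset.card_le_card fun i => by simp +contextual
  rw [hA, ← hN]
  set a := ((Finset.univ.filter fun i => q i ∧ p i).card : ℝ)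
  set b := ((Finset.univ.filter fun i => ¬ q i ∧ p i).card : ℝ)
  set c := ((Finset.univ.filter q).card : ℝ)
  set e := ((Finset.univ.filter fun i => ¬ q i).card : ℝ)
  have ha : 0 ≤ a := Nat.cast_nonneg _
  have hb : 0 ≤ b := Nat.cast_nonneg _
  have he : 0 ≤ e := Nat.cast_nonneg _
  have hce : 0 < c + e := by linarith
  have e1 : 1 - c / (c + e) = e / (c + e) := by field_simp; ring
  have e2 : a / c - (a + b) / (c + e) = (a / c * e - b) / (c + e) := by field_simp; ring
  have hac : a / c ≤ 1 := (div_le_one hQ).2 h1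
  have hac0 : 0 ≤ a / c := by positivity
  rw [e1, e2, abs_div, abs_of_pos hce]
  gcongr
  rw [abs_le]
  constructor <;> nlinarith

/-- Sampling `m` times with and without replacement from `n` points differ by at most `m ^ 2 / n`
in total variation. -/
lemma abs_card_injective_div_sub_productMass_le (hn : 0 < n) (hmn : m ≤ n) (x : Fin n → Fin k)
    (s : Finset (Fin m → Fin k)) :
    |((Finset.univ.filter fun j : Fin m → Fin n =>
          Function.Injective j ∧ x ∘ j ∈ s).card : ℝ) /
        (Finset.univ.filter fun j : Fin m → Fin n => Function.Injective j).card -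
        productMass (empirical x) s| ≤ (m : ℝ) ^ 2 / n := by
  have h := abs_card_div_sub_card_div_le (fun j : Fin m → Fin n => x ∘ j ∈ s)
    (fun j => Function.Injective j) ⟨Fin.castLE hmn, Fin.castLE_injective hmn⟩
  have h' := one_sub_le_card_injective_div hn hmn
  rw [productMass_empirical]
  simp only [Fintype.card_fun, Fintype.card_fin, Nat.cast_pow] at h
  refine h.trans ?_
  linarith

/-- Under exchangeable weights, the first `m` coordinates can be replaced by the average over all
injective choices of `m` coordinates. -/
lemma sum_restrict_eq_sum_average (hmn : m ≤ n) (w : (Fin n → Fin k) → ℝ)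
    (hw : ∀ x (σ : Equiv.Perm (Fin n)), w (x ∘ σ) = w x) (s : Finset (Fin m → Fin k)) :
    ∑ x : Fin n → Fin k with x ∘ Fin.castLE hmn ∈ s, w x =
      ∑ x, w x * (((Finset.univ.filter fun j : Fin m → Fin n =>
          Function.Injective j ∧ x ∘ j ∈ s).card : ℝ) /
        (Finset.univ.filter fun j : Fin m → Fin n => Function.Injective j).card) := by
  have hinj : ∀ j : Fin m → Fin n, Function.Injective j →
      ∑ x : Fin n → Fin k with x ∘ j ∈ s, w x =
        ∑ x : Fin n → Fin k with x ∘ Fin.castLE hmn ∈ s, w x := by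
    intro j hj
    -- Some permutation carries the first `m` indices to `j`, and the weights do not see it.
    obtain ⟨σ, hσ⟩ := Equiv.Perm.exists_extending_pair (Fin.castLE hmn) j
      (Fin.castLE_injective hmn) hj
    refine Finset.sum_bij (fun x _ => x ∘ σ) (fun x hx => ?_)
      (fun x _ y _ h => σ.surjective.injective_comp_right h) (fun y hy => ⟨y ∘ σ.symm, ?_, ?_⟩)
      fun x _ => (hw x σ).symm
    · have : (x ∘ σ) ∘ Fin.castLE hmn = x ∘ j := by
        funext i; simp [hσ]
      simpa [this] using hx
    · have : (y ∘ σ.symm) ∘ j = y ∘ Fin.castLE hmn := by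
        funext i; simp [← hσ]
      simpa [this] using hy
    · funext i; simp
  set I := Finset.univ.filter fun j : Fin m → Fin n => Function.Injective j
  have hI : (0 : ℝ) < I.card := by
    exact_mod_cast Finset.card_pos.2 ⟨Fin.castLE hmn, by simp [I, Fin.castLE_injective]⟩
  have hsum : ∑ j ∈ I, ∑ x : Fin n → Fin k with x ∘ j ∈ s, w x =
      I.card * ∑ x : Fin n → Fin k with x ∘ Fin.castLE hmn ∈ s, w x := by
    rw [← nsmul_eq_mul, ← Finset.sum_const]
    exact Finset.sum_congr rfl fun j hj => hinj j (Finset.mem_filter.1 hj).2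
  simp_rw [← mul_div_assoc]
  rw [← Finset.sum_div, eq_div_iff hI.ne', mul_comm, ← hsum]
  simp_rw [Finset.sum_filter]
  rw [Finset.sum_comm]
  refine Finset.sum_congr rfl fun x _ => ?_
  rw [← Finset.sum_filter, Finset.sum_const, nsmul_eq_mul, mul_comm, Finset.filter_filter]

/-- The finite de Finetti bound for exchangeable weights. -/
lemma abs_sum_restrict_sub_productMass_le (hn : 0 < n) (hmn : m ≤ n)
    (w : (Fin n → Fin k) → ℝ) (hw0 : ∀ x, 0 ≤ w x) (hw1 : ∑ x, w x = 1)
    (hw : ∀ x (σ : Equiv.Perm (Fin n)), w (x ∘ σ) = w x)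
    (R : Fin k → ℝ) (s : Finset (Fin m → Fin k)) :
    |∑ x : Fin n → Fin k with x ∘ Fin.castLE hmn ∈ s, w x - productMass R s| ≤
      (m : ℝ) ^ 2 / n + ∑ x, w x * |productMass (empirical x) s - productMass R s| := by
  rw [sum_restrict_eq_sum_average hmn w hw s]
  have h1 : productMass R s = ∑ x, w x * productMass R s := by rw [← Finset.sum_mul, hw1, one_mul]
  have h2 : (m : ℝ) ^ 2 / n = ∑ x, w x * ((m : ℝ) ^ 2 / n) := by
    rw [← Finset.sum_mul, hw1, one_mul]
  rw [h2, ← Finset.sum_add_distrib]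
  nth_rewrite 1 [h1]
  rw [← Finset.sum_sub_distrib]
  refine (Finset.abs_sum_le_sum_abs _ _).trans (Finset.sum_le_sum fun x _ => ?_)
  rw [← mul_sub, abs_mul, abs_of_nonneg (hw0 x), ← mul_add]
  refine mul_le_mul_of_nonneg_left ?_ (hw0 x)
  refine (abs_sub_le _ (productMass (empirical x) s) _).trans ?_
  gcongr
  exact abs_card_injective_div_sub_productMass_le hn hmn x s

end Exchangeable

/-! ### Lattice of feasible types -/

section Lattice

variable {k d : ℕ} {h : Fin k → Fin d → ℝ} {α : Fin d → ℝ}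

lemma exists_occurrences_eq (c : Fin k → ℕ) :
    ∃ x : Fin (∑ a, c a) → Fin k, occurrences x = c := by
  refine ⟨fun i => (finSigmaFinEquiv.symm i).1, funext fun a => ?_⟩
  rw [occurrences, ← Fintype.card_subtype]
  calc Fintype.card {i // (finSigmaFinEquiv.symm i).1 = a}
      = Fintype.card {i : (a : Fin k) × Fin (c a) // i.1 = a} :=
        Fintype.card_congr (finSigmaFinEquiv.symm.subtypeEquiv fun _ => Iff.rfl)
    _ = c a := by
        have : (Finset.univ.filter fun i : (a : Fin k) × Fin (c a) => i.1 = a) =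
            Finset.univ.map ⟨Sigma.mk a, sigma_mk_injective⟩ := by
          ext ⟨b, i⟩
          simp only [Finset.mem_filter, Finset.mem_univ, true_and, Finset.mem_map,
            Function.Embedding.coeFn_mk]
          constructor
          · rintro rfl; exact ⟨i, rfl⟩
          · rintro ⟨j, hj⟩; exact (congrArg Sigma.fst hj).symm
        rw [Fintype.card_subtype, this, Finset.card_map, Finset.card_univ, Fintype.card_fin]

/-- The integral vectors in the tangent space. -/
def integralTangents (h : Fin k → Fin d → ℝ) : Set (Fin k → ℝ) :=
  {v | (∀ a, ∃ z : ℤ, v a = z) ∧ ∑ a, v a = 0 ∧ ∑ a, v a • h a = 0}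

/-- Multiplying the difference by `n * n'` clears both denominators. -/
lemma sub_mem_span_integralTangents {n n' : ℕ} {P P' : Fin k → ℝ} (hP : P ∈ feasibleTypes h α n)
    (hP' : P' ∈ feasibleTypes h α n') : P - P' ∈ Submodule.span ℝ (integralTangents h) := by
  obtain ⟨⟨⟨-, hP1⟩, hPα⟩, x, rfl⟩ := hP
  obtain ⟨⟨⟨-, hP1'⟩, hPα'⟩, x', rfl⟩ := hP'
  -- The empty sample has the zero vector as empirical distribution, so mass one excludes it.
  have hpos : ∀ {j : ℕ} (y : Fin j → Fin k), ∑ a, empirical y a = 1 → (j : ℝ) ≠ 0 := by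
    intro j y hy hj
    simp [empirical, hj] at hy
  have hn := hpos x hP1
  have hn' := hpos x' hP1'
  have hmem : ((n : ℝ) * n') • (empirical x - empirical x') ∈ integralTangents h := by
    refine ⟨fun a => ⟨occurrences x a * n' - occurrences x' a * n, ?_⟩, ?_, ?_⟩
    · simp only [Pi.smul_apply, Pi.sub_apply, smul_eq_mul, empirical_apply]
      push_cast
      field_simp
    · simp only [Pi.smul_apply, Pi.sub_apply, smul_eq_mul]
      rw [← Finset.mul_sum, Finset.sum_sub_distrib, hP1, hP1', sub_self, mul_zero]
    · simp only [Pi.smul_apply, Pi.sub_apply, smul_assoc, sub_smul]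
      rw [← Finset.smul_sum, Finset.sum_sub_distrib, hPα, hPα', sub_self, smul_zero]
  have := Submodule.smul_mem _ (((n : ℝ) * n')⁻¹) (Submodule.subset_span (R := ℝ) hmem)
  rwa [smul_smul, inv_mul_cancel₀ (mul_ne_zero hn hn'), one_smul] at this

/-- A limit of feasible types lies within `O(1 / n)` of the feasible types of sample size `n`. -/
lemma exists_feasibleType_near {P : Fin k → ℝ} (hP : P ∈ feasible h α)
    (hcl : P ∈ closure (⋃ n, feasibleTypes h α n)) :
    ∃ K : ℝ, 0 ≤ K ∧ ∀ᶠ n : ℕ in atTop, (feasibleTypes h α n).Nonempty →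
      ∃ x : Fin n → Fin k, empirical x ∈ feasible h α ∧ ∀ a, |empirical x a - P a| ≤ K / n := by
  -- Linear independence serves to make the integral spanning set finite, hence the rounding error
  -- bounded uniformly in `n`.
  obtain ⟨b, hbD, hbspan, hbli⟩ := exists_linearIndependent ℝ (integralTangents h)
  have hbfin : b.Finite := hbli.setFinite
  obtain ⟨B, rfl⟩ := hbfin.exists_finset_coe
  choose! z hz using fun v (hv : v ∈ B) => (hbD (Finset.mem_coe.2 hv)).1
  set K := ∑ v ∈ B, ∑ a, |v a|
  have hK : 0 ≤ K := Finset.sum_nonneg fun v _ => Finset.sum_nonneg fun a _ => abs_nonneg _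
  have hlim : Tendsto (fun n : ℕ => K / n) atTop (nhds 0) := tendsto_const_div_atTop_nhds_zero_nat K
  -- An error below every mass of `P` keeps the rounded point strictly positive.
  have hpos : ∀ᶠ n : ℕ in atTop, ∀ a, K / n < P a :=
    eventually_all.2 fun a => hlim.eventually_lt_const (hP.1.1 a)
  refine ⟨K, hK, ?_⟩
  filter_upwards [hpos, eventually_gt_atTop 0] with n hn hn0
  rintro ⟨P₀, hP₀⟩
  have hn' : (0 : ℝ) < n := by exact_mod_cast hn0
  have hmem : P - P₀ ∈ Submodule.span ℝ (B : Set (Fin k → ℝ)) := by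
    rw [hbspan]
    -- All feasible types lie in one translate of the span, which is closed and so contains the
    -- limit `P`.
    have hclosed : IsClosed {R | R - P₀ ∈ Submodule.span ℝ (integralTangents h)} :=
      (Submodule.closed_of_finiteDimensional _).preimage (continuous_id.sub continuous_const)
    refine closure_minimal ?_ hclosed hcl
    refine Set.iUnion_subset fun j R hR => ?_
    exact sub_mem_span_integralTangents hR hP₀
  obtain ⟨f, -, hf⟩ := Submodule.mem_span_finset.1 hmem
  obtain ⟨⟨⟨hP₀pos, hP₀1⟩, hP₀α⟩, x₀, rfl⟩ := hP₀
  -- Rounding the coefficients of `P - P₀` down to multiples of `1 / n` preserves the linear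
  -- constraints and leaves `n R` integral.
  set R : Fin k → ℝ := empirical x₀ + ∑ v ∈ B, ((⌊n * f v⌋ : ℝ) / n) • v
  have hB : ∀ v ∈ B, ∑ a, v a = 0 ∧ ∑ a, v a • h a = 0 := fun v hv => (hbD hv).2
  have hRapp : ∀ a, R a = empirical x₀ a + ∑ v ∈ B, ((⌊n * f v⌋ : ℝ) / n) * v a := by
    intro a
    simp [R, Finset.sum_apply]
  have hnear : ∀ a, |R a - P a| ≤ K / n := by
    intro a
    have hPa : P a = empirical x₀ a + ∑ v ∈ B, f v * v a := by
      have := congrFun hf a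
      simp only [Finset.sum_apply, Pi.smul_apply, smul_eq_mul, Pi.sub_apply] at this
      linarith
    rw [hPa, hRapp, add_sub_add_left_eq_sub, ← Finset.sum_sub_distrib]
    refine (Finset.abs_sum_le_sum_abs _ _).trans ?_
    rw [Finset.sum_div]
    refine Finset.sum_le_sum fun v _ => ?_
    rw [← sub_mul, abs_mul, div_eq_inv_mul (∑ a, |v a|)]
    have h1 : |(⌊n * f v⌋ : ℝ) / n - f v| ≤ (n : ℝ)⁻¹ := by
      have : (⌊n * f v⌋ : ℝ) / n - f v = -((n : ℝ)⁻¹ * Int.fract (n * f v)) := by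
        rw [Int.fract]
        field_simp
        ring
      rw [this, abs_neg, abs_of_nonneg (mul_nonneg (by positivity) (Int.fract_nonneg _))]
      exact mul_le_of_le_one_right (by positivity) (Int.fract_lt_one _).le
    have h2 : |v a| ≤ ∑ a, |v a| :=
      Finset.single_le_sum (f := fun a => |v a|) (fun _ _ => abs_nonneg _) (Finset.mem_univ a)
    gcongr
  have hRpos : ∀ a, 0 < R a := by
    intro a
    have := (abs_le.1 (hnear a)).1
    linarith [hn a]
  have hR1 : ∑ a, R a = 1 := by
    simp_rw [hRapp]
    rw [Finset.sum_add_distrib, hP₀1, Finset.sum_comm, Finset.sum_eq_zero, add_zero]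
    intro v hv
    rw [← Finset.mul_sum, (hB v hv).1, mul_zero]
  have hRα : ∑ a, R a • h a = α := by
    simp_rw [hRapp, add_smul, Finset.sum_smul]
    rw [Finset.sum_add_distrib, hP₀α, Finset.sum_comm, Finset.sum_eq_zero, add_zero]
    intro v hv
    simp_rw [mul_smul]
    rw [← Finset.smul_sum, (hB v hv).2, smul_zero]
  have hRint : ∀ a, ∃ c : ℕ, R a = c / n := by
    intro a
    have hZ : R a = ((occurrences x₀ a + ∑ v ∈ B, ⌊n * f v⌋ * z v a : ℤ) : ℝ) / n := by
      rw [hRapp, empirical_apply]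
      push_cast
      rw [add_div, Finset.sum_div]
      congr 1
      refine Finset.sum_congr rfl fun v hv => ?_
      rw [hz v hv]
      ring
    have hnn : 0 ≤ (occurrences x₀ a + ∑ v ∈ B, ⌊n * f v⌋ * z v a : ℤ) := by
      have := hRpos a
      rw [hZ] at this
      exact_mod_cast ((div_pos_iff_of_pos_right hn').1 this).le
    obtain ⟨c, hc⟩ := Int.eq_ofNat_of_zero_le hnn
    exact ⟨c, by rw [hZ, hc]; simp⟩
  choose c hc using hRint
  have hcsum : ∑ a, c a = n := by
    simp_rw [hc] at hR1
    rw [← Finset.sum_div, div_eq_one_iff_eq hn'.ne'] at hR1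
    exact_mod_cast hR1
  obtain ⟨x, hx⟩ : ∃ x : Fin n → Fin k, occurrences x = c := by
    have := exists_occurrences_eq c
    rwa [hcsum] at this
  have hxR : empirical x = R := by
    funext a
    rw [empirical_apply, hx, hc]
  exact ⟨x, hxR ▸ ⟨⟨hRpos, hR1⟩, hRα⟩, hxR ▸ hnear⟩

end Lattice

/-! ### Information projection and the projected Hessian -/

section Projection

variable {k d : ℕ} {h : Fin k → Fin d → ℝ} {α : Fin d → ℝ} {P Q : Fin k → ℝ}

/-- The first order condition at an information projection. -/
lemma IsInfoProjection.sum_mul_log_eq_zero (hQ : Q ∈ openSimplex k)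
    (hP : IsInfoProjection Q (feasible h α) P) {v : Fin k → ℝ} (hv : ∑ a, v a = 0)
    (hvh : ∑ a, v a • h a = 0) : ∑ a, v a * Real.log (P a / Q a) = 0 := by
  obtain ⟨⟨⟨hPpos, hP1⟩, hPα⟩, hmin⟩ := hP
  have hline : ∀ a, HasDerivAt (fun t : ℝ => P a + t * v a) (v a) 0 := fun a => by
    simpa using ((hasDerivAt_id (0 : ℝ)).mul_const (v a)).const_add (P a)
  have hderiv : HasDerivAt (fun t : ℝ => kl (fun a => P a + t * v a) Q)
      (∑ a, (v a * Real.log (P a / Q a) + v a)) 0 := by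
    unfold kl
    refine HasDerivAt.fun_sum fun a _ => ?_
    have hp := hPpos a
    have hq := hQ.1 a
    have := (hline a).mul (((hline a).div_const (Q a)).log (by simp; constructor <;> positivity))
    refine this.congr_deriv ?_
    simp only [zero_mul, add_zero]
    field_simp
  -- Since `P` is strictly positive, small `t` of either sign stay feasible, so the minimum is
  -- two-sided.
  have hfeas : ∀ᶠ t : ℝ in nhds 0, (fun a => P a + t * v a) ∈ feasible h α := by
    have hpos : ∀ᶠ t : ℝ in nhds 0, ∀ a, 0 < P a + t * v a :=
      eventually_all.2 fun a => (hline a).continuousAt.eventually_const_lt (by simpa using hPpos a)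
    filter_upwards [hpos] with t ht
    refine ⟨⟨ht, ?_⟩, ?_⟩
    · rw [Finset.sum_add_distrib, ← Finset.mul_sum, hv, hP1]
      simp
    · simp_rw [add_smul, mul_smul]
      rw [Finset.sum_add_distrib, ← Finset.smul_sum, hvh, hPα]
      simp
  have hloc : IsLocalMin (fun t : ℝ => kl (fun a => P a + t * v a) Q) 0 := by
    filter_upwards [hfeas] with t ht
    simpa using hmin _ ht
  have := hloc.hasDerivAt_eq_zero hderiv
  rwa [Finset.sum_add_distrib, hv, add_zero] at this

/-- On feasible samples the likelihoods of `Q` and of its information projection are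
proportional. -/
lemma IsInfoProjection.prod_eq {n : ℕ} (hQ : Q ∈ openSimplex k)
    (hP : IsInfoProjection Q (feasible h α) P) {x : Fin n → Fin k}
    (hx : empirical x ∈ feasible h α) :
    ∏ i, Q (x i) = Real.exp (-(n * kl P Q)) * ∏ i, P (x i) := by
  obtain ⟨⟨-, hx1⟩, hxα⟩ := hx
  have horth := hP.sum_mul_log_eq_zero hQ (v := fun a => empirical x a - P a)
    (by rw [Finset.sum_sub_distrib, hx1, hP.1.1.2, sub_self])
    (by simp_rw [sub_smul]; rw [Finset.sum_sub_distrib, hxα, hP.1.2, sub_self])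
  have hkl : kl P Q = ∑ a, empirical x a * Real.log (P a / Q a) := by
    simp_rw [sub_mul] at horth
    rw [Finset.sum_sub_distrib] at horth
    rw [kl]
    linarith
  rw [hkl, ← sum_comp_eq_sum_empirical (fun a => Real.log (P a / Q a)),
    ← Finset.sum_neg_distrib, Real.exp_sum, ← Finset.prod_mul_distrib]
  refine Finset.prod_congr rfl fun i _ => ?_
  have h1 := hP.1.1.1 (x i)
  have h2 := hQ.1 (x i)
  rw [Real.exp_neg, Real.exp_log (by positivity)]
  field_simp

lemma minMass_le (P : Fin k → ℝ) (a : Fin k) : minMass P ≤ P a :=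
  ciInf_le (Set.finite_range P).bddBelow a

lemma minMass_pos (hk : 0 < k) (hP : ∀ a, 0 < P a) : 0 < minMass P := by
  have : Nonempty (Fin k) := ⟨⟨0, hk⟩⟩
  obtain ⟨a, ha⟩ := exists_eq_ciInf_of_finite (f := P)
  rw [minMass, ← ha]
  exact hP a

lemma diagInv_apply (P : Fin k → ℝ) (v : EuclideanSpace ℝ (Fin k)) (a : Fin k) :
    diagInv P v a = v a / P a := by
  rw [diagInv, Matrix.ofLp_toLpLin, Matrix.toLin'_apply, Matrix.mulVec_diagonal]
  ring

lemma inner_projHessian (P : Fin k → ℝ) (v w : tangentSpace h) :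
    inner ℝ (projHessian h P v) w =
      ∑ a, (v : EuclideanSpace ℝ (Fin k)) a * (w : EuclideanSpace ℝ (Fin k)) a / P a := by
  have : inner ℝ (projHessian h P v) w =
      inner ℝ (diagInv P (v : EuclideanSpace ℝ (Fin k))) (w : EuclideanSpace ℝ (Fin k)) :=
    Submodule.inner_orthogonalProjectionOnto_eq_of_mem_right w _
  rw [this, PiLp.inner_apply]
  refine Finset.sum_congr rfl fun a _ => ?_
  rw [diagInv_apply]
  simp
  ring

lemma isSymmetric_projHessian (P : Fin k → ℝ) : (projHessian h P).IsSymmetric := by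
  intro v w
  rw [real_inner_comm _ v, inner_projHessian, inner_projHessian]
  exact Finset.sum_congr rfl fun a _ => by ring

/-- At an eigenvector, `μ` is the ratio of `∑ v a ^ 2 / P a` to `∑ v a ^ 2`, and `minMass P ≤ P a ≤
1`. -/
lemma hasEigenvalue_projHessian_bounds (hP : P ∈ openSimplex k) (hp : 0 < minMass P) {μ : ℝ}
    (hμ : (projHessian h P).HasEigenvalue μ) : 1 ≤ μ ∧ μ ≤ 1 / minMass P := by
  obtain ⟨v, hv⟩ := hμ.exists_hasEigenvector
  have hinner : μ * ‖v‖ ^ 2 = ∑ a, (v : EuclideanSpace ℝ (Fin k)) a ^ 2 / P a := by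
    rw [← real_inner_self_eq_norm_sq, ← real_inner_smul_left, ← hv.apply_eq_smul,
      inner_projHessian]
    exact Finset.sum_congr rfl fun a _ => by ring
  have hnorm : ‖v‖ ^ 2 = ∑ a, (v : EuclideanSpace ℝ (Fin k)) a ^ 2 := by
    rw [Submodule.coe_norm, EuclideanSpace.norm_sq_eq]
    simp
  have hpos : 0 < ‖v‖ ^ 2 := by
    have := norm_pos_iff.2 hv.2
    positivity
  constructor
  · refine le_of_mul_le_mul_right ?_ hpos
    rw [one_mul, hinner, hnorm]
    refine Finset.sum_le_sum fun a _ => ?_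
    exact le_div_self (sq_nonneg _) (hP.1 a) (openSimplex_le_one hP a)
  · refine le_of_mul_le_mul_right ?_ hpos
    rw [hinner, hnorm, Finset.mul_sum]
    refine Finset.sum_le_sum fun a _ => ?_
    rw [div_mul_eq_mul_div, one_mul]
    have := minMass_le P a
    gcongr

/-- On a nonzero tangent space the infimum of the Rayleigh quotient is an eigenvalue, so `sInf` is
not taken over the empty set. -/
lemma lambdaMin_projHessian_bounds (hP : P ∈ openSimplex k) (hp : 0 < minMass P)
    (hT : tangentSpace h ≠ ⊥) :
    1 ≤ lambdaMin (projHessian h P) ∧ lambdaMin (projHessian h P) ≤ 1 / minMass P := by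
  have : Nontrivial (tangentSpace h) := Submodule.nontrivial_iff_ne_bot.2 hT
  have hne := (isSymmetric_projHessian (h := h) P).hasEigenvalue_iInf_of_finiteDimensional
  constructor
  · exact le_csInf ⟨_, hne⟩ fun μ hμ => (hasEigenvalue_projHessian_bounds hP hp hμ).1
  · refine (csInf_le ⟨1, fun μ hμ => ?_⟩ hne).trans (hasEigenvalue_projHessian_bounds hP hp hne).2
    exact (hasEigenvalue_projHessian_bounds hP hp hμ).1

end Projection

/-! ### From measures to finite sums -/

section Measure

variable {k d : ℕ} {h : Fin k → Fin d → ℝ} {α : Fin d → ℝ} {P Q : Fin k → ℝ}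

lemma law_singleton (P : Fin k → ℝ) (a : Fin k) : law P {a} = ENNReal.ofReal (P a) := by
  simp [law, Set.indicator_apply]

lemma isProbabilityMeasure_law (hP : P ∈ openSimplex k) : IsProbabilityMeasure (law P) := by
  constructor
  simp only [law, Measure.coe_finsetSum, Finset.sum_apply, Measure.smul_apply, measure_univ,
    smul_eq_mul, mul_one]
  rw [← ENNReal.ofReal_sum_of_nonneg fun a _ => (hP.1 a).le, hP.2, ENNReal.ofReal_one]

lemma pi_law_real (hP : P ∈ openSimplex k) {m : ℕ} (s : Finset (Fin m → Fin k)) :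
    (Measure.pi fun _ : Fin m => law P).real s = productMass P s := by
  have := isProbabilityMeasure_law hP
  rw [← sum_measureReal_singleton, productMass]
  refine Finset.sum_congr rfl fun y _ => ?_
  rw [measureReal_def, Measure.pi_singleton, ENNReal.toReal_prod]
  refine Finset.prod_congr rfl fun i _ => ?_
  rw [law_singleton, ENNReal.toReal_ofReal (hP.1 _).le]

variable {Ω : Type*} [MeasurableSpace Ω] {Pr : Measure Ω} {X : ℕ → Ω → Fin k}

lemma IsIIDSample.map_eq_pi [IsProbabilityMeasure Pr] (hX : IsIIDSample Pr X Q) (n : ℕ) :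
    Pr.map (fun ω (i : Fin n) => X i ω) = Measure.pi fun _ : Fin n => law Q := by
  have hind : iIndepFun (fun i : Fin n => X i) Pr := hX.2.1.precomp Fin.val_injective
  rw [(iIndepFun_iff_map_fun_eq_pi_map fun i : Fin n => (hX.1 i).aemeasurable).1 hind]
  congr 1
  funext i
  exact hX.2.2 i

/-- The conditional law of the first `m` observations as a quotient of finite sums. -/
lemma predictiveLaw_real [IsProbabilityMeasure Pr] (hQ : Q ∈ openSimplex k)
    (hX : IsIIDSample Pr X Q) {n m : ℕ} (hmn : m ≤ n) (s : Finset (Fin m → Fin k)) (B : Finset (Fin n → Fin k))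
    (hB : ∀ x, x ∈ B ↔ empirical x ∈ feasibleTypes h α n) :
    (predictiveLaw Pr X h α n m).real s =
      (∑ x ∈ B with x ∘ Fin.castLE hmn ∈ s, ∏ i, Q (x i)) / ∑ x ∈ B, ∏ i, Q (x i) := by
  set Y : Ω → Fin n → Fin k := fun ω i => X i ω
  have hY : Measurable Y := measurable_pi_lambda _ fun i => hX.1 i
  have hev : feasibleEvent X h α n = Y ⁻¹' (B : Set (Fin n → Fin k)) := by
    ext ω
    simp [feasibleEvent, hB, Y]
  have hmeas : ∀ A : Finset (Fin n → Fin k), Pr.real (Y ⁻¹' A) = ∑ x ∈ A, ∏ i, Q (x i) := by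
    intro A
    rw [← map_measureReal_apply hY A.measurableSet, hX.map_eq_pi n, pi_law_real hQ, productMass]
  have hZ : Measurable fun ω (i : Fin m) => X i ω := measurable_pi_lambda _ fun i => hX.1 i
  have hpre : Y ⁻¹' (B : Set (Fin n → Fin k)) ∩ (fun ω (i : Fin m) => X i ω) ⁻¹' s =
      Y ⁻¹' (B.filter fun x => x ∘ Fin.castLE hmn ∈ s : Finset (Fin n → Fin k)) := by
    ext ω
    simp only [Set.mem_inter_iff, Set.mem_preimage, Finset.mem_coe, Finset.mem_filter]
    rfl
  rw [predictiveLaw, map_measureReal_apply hZ s.measurableSet, hev,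
    measureReal_def, cond_apply (hY B.measurableSet), ENNReal.toReal_mul, ENNReal.toReal_inv, hpre,
    ← measureReal_def, ← measureReal_def, hmeas, hmeas, div_eq_inv_mul]

lemma tvDist_le {S : Type*} [MeasurableSpace S] [Fintype S] {μ ν : Measure S} {c : ℝ}
    (hc : ∀ s : Finset S, |μ.real s - ν.real s| ≤ c) : tvDist μ ν ≤ c := by
  have : Nonempty {s : Set S // MeasurableSet s} := ⟨⟨∅, MeasurableSet.empty⟩⟩
  refine ciSup_le fun s => ?_
  classical
  have := hc (s : Set S).toFinset
  rwa [Set.coe_toFinset] at this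

/-- `μ` is only assumed to have mass at most one because conditioning on a null event yields the
zero measure. -/
lemma tvDist_le_one {S : Type*} [MeasurableSpace S] [Fintype S] {μ ν : Measure S}
    (hμ : μ Set.univ ≤ 1) [IsProbabilityMeasure ν] : tvDist μ ν ≤ 1 := by
  have : IsFiniteMeasure μ := ⟨hμ.trans_lt ENNReal.one_lt_top⟩
  refine tvDist_le fun s => ?_
  have h1 : μ.real s ≤ 1 := by
    rw [measureReal_def]
    exact ENNReal.toReal_le_of_le_ofReal zero_le_one
      (by simpa using (measure_mono (Set.subset_univ _)).trans hμ)
  have h2 : ν.real s ≤ 1 := measureReal_le_one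
  have h3 : 0 ≤ μ.real s := measureReal_nonneg
  have h4 : 0 ≤ ν.real s := measureReal_nonneg
  rw [abs_le]
  constructor <;> linarith

lemma tvDist_predictiveLaw_le_one (hP : P ∈ openSimplex k) (hX : ∀ i, Measurable (X i))
    (n m : ℕ) :
    tvDist (predictiveLaw Pr X h α n m) (Measure.pi fun _ : Fin m => law P) ≤ 1 := by
  have := isProbabilityMeasure_law hP
  refine tvDist_le_one ?_
  rw [predictiveLaw, Measure.map_apply (measurable_pi_lambda _ fun i : Fin m => hX i)
    MeasurableSet.univ]
  exact prob_le_one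

end Measure

/-! ### Concentration of the conditioned type -/

section Concentration

variable {k d : ℕ} {h : Fin k → Fin d → ℝ} {α : Fin d → ℝ} {P : Fin k → ℝ}

/-- Conditionally on feasibility, the empirical distribution is close to `P` in divergence. -/
lemma sum_prod_far_le {n : ℕ} (hn : 0 < n) (hP : P ∈ openSimplex k) {p K : ℝ} (hp : 0 < p)
    (hpP : ∀ a, p ≤ P a) {x₀ : Fin n → Fin k} (hx₀ : empirical x₀ ∈ feasible h α)
    (hnear : ∀ a, |empirical x₀ a - P a| ≤ K / n) (B : Finset (Fin n → Fin k))
    (hB : ∀ x, x ∈ B ↔ empirical x ∈ feasibleTypes h α n) (δ : ℝ) :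
    ∑ x ∈ B with δ < kl (empirical x) P, ∏ i, P (x i) ≤
      ((n : ℝ) + 1) ^ k * Real.exp (-(n * δ)) * ((Real.exp 1 * n) ^ k * Real.exp (k * K ^ 2 / p)) *
        ∑ x ∈ B, ∏ i, P (x i) := by
  have hn' : (1 : ℝ) ≤ n := by exact_mod_cast hn
  have hnn : ∀ x : Fin n → Fin k, 0 ≤ ∏ i, P (x i) := fun x =>
    Finset.prod_nonneg fun i _ => (hP.1 _).le
  have hupper : ∑ x ∈ B with δ < kl (empirical x) P, ∏ i, P (x i) ≤
      ((n : ℝ) + 1) ^ k * Real.exp (-(n * δ)) :=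
    (Finset.sum_le_sum_of_subset_of_nonneg (Finset.filter_subset_filter _ (Finset.subset_univ _))
      fun x _ _ => hnn x).trans (sum_prod_of_lt_kl_le hn hP.1 δ)
  have hkl : n * kl (empirical x₀) P ≤ k * K ^ 2 / p := by
    calc n * kl (empirical x₀) P ≤ n * ∑ a, (empirical x₀ a - P a) ^ 2 / P a := by
          gcongr
          exact kl_le_sum_sq_div hx₀.1 hP
      _ ≤ n * ∑ _a : Fin k, (K / n) ^ 2 / p := by
          refine mul_le_mul_of_nonneg_left (Finset.sum_le_sum fun a _ => ?_) (by positivity)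
          exact div_le_div₀ (sq_nonneg _)
            (sq_le_sq' (abs_le.1 (hnear a)).1 (abs_le.1 (hnear a)).2) hp (hpP a)
      _ = k * K ^ 2 / p / n := by
          simp only [Finset.sum_const, Finset.card_univ, Fintype.card_fin, nsmul_eq_mul]
          field_simp
      _ ≤ k * K ^ 2 / p := div_le_self (by positivity) hn'
  have hclass : ∑ y : Fin n → Fin k with empirical y = empirical x₀, ∏ i, P (y i) ≤
      ∑ x ∈ B, ∏ i, P (x i) := by
    refine Finset.sum_le_sum_of_subset_of_nonneg (fun y hy => ?_) fun x _ _ => hnn x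
    rw [hB, (Finset.mem_filter.1 hy).2]
    exact ⟨hx₀, x₀, rfl⟩
  -- The type class of `x₀` alone already gives feasibility polynomial mass, so the far mass may be
  -- multiplied by this factor.
  have hlower : 1 ≤ (Real.exp 1 * n) ^ k * Real.exp (k * K ^ 2 / p) * ∑ x ∈ B, ∏ i, P (x i) := by
    have h1 := exp_neg_kl_le_sum_prod hn hP.1 x₀ hx₀.1.1
    calc (1 : ℝ) = Real.exp (-(n * kl (empirical x₀) P)) * Real.exp (n * kl (empirical x₀) P) := by
          rw [← Real.exp_add, neg_add_cancel, Real.exp_zero]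
      _ ≤ ((Real.exp 1 * n) ^ k * ∑ x ∈ B, ∏ i, P (x i)) * Real.exp (k * K ^ 2 / p) := by
          refine mul_le_mul (h1.trans ?_) (Real.exp_le_exp.2 hkl) (Real.exp_pos _).le ?_
          · gcongr
          · have := Finset.sum_nonneg fun x (_ : x ∈ B) => hnn x
            positivity
      _ = _ := by ring
  refine hupper.trans ?_
  rw [mul_assoc]
  exact le_mul_of_one_le_right (by positivity) hlower

end Concentration

/-! ### The conditional limit bound and its asymptotics -/

section Main

variable {k d : ℕ} {h : Fin k → Fin d → ℝ} {α : Fin d → ℝ} {P Q : Fin k → ℝ}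
  {Ω : Type*} [MeasurableSpace Ω] {Pr : Measure Ω} [IsProbabilityMeasure Pr] {X : ℕ → Ω → Fin k}

/-- The non-asymptotic conditional limit bound, with a free divergence threshold `δ`. -/
lemma tvDist_predictiveLaw_le (hQ : Q ∈ openSimplex k)
    (hP : IsInfoProjection Q (feasible h α) P) (hX : IsIIDSample Pr X Q) {n m : ℕ} (hn : 0 < n)
    (hmn : m ≤ n) {p K : ℝ} (hp : 0 < p) (hpP : ∀ a, p ≤ P a) {x₀ : Fin n → Fin k}
    (hx₀ : empirical x₀ ∈ feasible h α) (hnear : ∀ a, |empirical x₀ a - P a| ≤ K / n) (δ : ℝ) :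
    tvDist (predictiveLaw Pr X h α n m) (Measure.pi fun _ : Fin m => law P) ≤
      (m : ℝ) ^ 2 / n + (m * (2 * k * √δ) + ((n : ℝ) + 1) ^ k * Real.exp (-(n * δ)) *
        ((Real.exp 1 * n) ^ k * Real.exp (k * K ^ 2 / p))) := by
  classical
  have hPs : P ∈ openSimplex k := hP.1.1
  set B : Finset (Fin n → Fin k) := Finset.univ.filter fun x => empirical x ∈ feasibleTypes h α n
  have hB : ∀ x, x ∈ B ↔ empirical x ∈ feasibleTypes h α n := by simp [B]
  have hBf : ∀ x ∈ B, empirical x ∈ feasible h α := fun x hx => ((hB x).1 hx).1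
  set Z := ∑ x ∈ B, ∏ i, P (x i)
  have hprod : ∀ x : Fin n → Fin k, 0 < ∏ i, P (x i) := fun x =>
    Finset.prod_pos fun i _ => hPs.1 _
  have hZ : 0 < Z := Finset.sum_pos (fun x _ => hprod x) ⟨x₀, (hB x₀).2 ⟨hx₀, x₀, rfl⟩⟩
  -- The product law of `P` conditioned on feasibility; it is exchangeable because feasibility and
  -- likelihood depend only on the type.
  set w : (Fin n → Fin k) → ℝ := fun x => if x ∈ B then (∏ i, P (x i)) / Z else 0
  have hw0 : ∀ x, 0 ≤ w x := by
    intro x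
    simp only [w]
    split_ifs
    · exact (div_pos (hprod x) hZ).le
    · exact le_rfl
  have hw1 : ∑ x, w x = 1 := by
    rw [← Finset.sum_filter, Finset.filter_mem_eq_inter, Finset.univ_inter, ← Finset.sum_div,
      div_self hZ.ne']
  have hwsum : ∀ (c : (Fin n → Fin k) → Prop) [DecidablePred c],
      ∑ x with c x, w x = (∑ x ∈ B with c x, ∏ i, P (x i)) / Z := by
    intro c _
    simp only [w]
    rw [← Finset.sum_filter, Finset.filter_filter, Finset.sum_div]
    refine Finset.sum_congr ?_ fun _ _ => rfl
    ext x
    simp [and_comm]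
  have hwperm : ∀ x (σ : Equiv.Perm (Fin n)), w (x ∘ σ) = w x := by
    intro x σ
    have h1 : x ∘ σ ∈ B ↔ x ∈ B := by rw [hB, hB, empirical_comp_perm]
    have h2 : ∏ i, P ((x ∘ σ) i) = ∏ i, P (x i) := Equiv.prod_comp σ fun i => P (x i)
    simp only [w, h1, h2]
  refine tvDist_le fun s => ?_
  have hlaw : (predictiveLaw Pr X h α n m).real s =
      ∑ x : Fin n → Fin k with x ∘ Fin.castLE hmn ∈ s, w x := by
    rw [predictiveLaw_real hQ hX hmn s B hB]
    -- The factor `exp (-(n * kl P Q))` cancels in the quotient, which turns `Q` into `P`.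
    rw [Finset.sum_congr rfl fun x hx => hP.prod_eq hQ (hBf x (Finset.mem_filter.1 hx).1),
      Finset.sum_congr (s₁ := B) rfl fun x hx => hP.prod_eq hQ (hBf x hx),
      ← Finset.mul_sum, ← Finset.mul_sum, mul_div_mul_left _ _ (Real.exp_pos _).ne',
      hwsum]
  rw [hlaw, pi_law_real hPs]
  refine (abs_sum_restrict_sub_productMass_le hn hmn w hw0 hw1 hwperm P s).trans ?_
  gcongr
  -- Near types are bounded through their divergence, far types by the trivial bound one.
  have hterm : ∀ x, w x * |productMass (empirical x) s - productMass P s| ≤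
      w x * (m * (2 * k * √δ)) + if δ < kl (empirical x) P then w x else 0 := by
    intro x
    by_cases hx : x ∈ B
    · have hxs : empirical x ∈ openSimplex k := (hBf x hx).1
      split_ifs with hδ
      · have h1 := productMass_nonneg (fun a => (hxs.1 a).le) s
        have h2 := productMass_le_one (fun a => (hxs.1 a).le) hxs.2 s
        have h3 := productMass_nonneg (fun a => (hPs.1 a).le) s
        have h4 := productMass_le_one (fun a => (hPs.1 a).le) hPs.2 s
        have h5 : |productMass (empirical x) s - productMass P s| ≤ 1 := by
          rw [abs_le]
          constructor <;> linarith
        refine (mul_le_of_le_one_right (hw0 x) h5).trans ?_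
        exact le_add_of_nonneg_left (mul_nonneg (hw0 x) (by positivity))
      · rw [add_zero]
        refine mul_le_mul_of_nonneg_left ?_ (hw0 x)
        refine (abs_productMass_sub_le (fun a => (hxs.1 a).le) hxs.2 (fun a => (hPs.1 a).le)
          hPs.2 s).trans ?_
        refine mul_le_mul_of_nonneg_left ?_ (by positivity)
        refine (sum_abs_sub_le_sqrt_kl hxs hPs).trans ?_
        gcongr
        exact not_lt.1 hδ
    · simp [w, hx]
  refine (Finset.sum_le_sum fun x _ => hterm x).trans ?_
  rw [Finset.sum_add_distrib, ← Finset.sum_mul, hw1, one_mul]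
  gcongr
  have hfar := sum_prod_far_le hn hPs hp hpP hx₀ hnear B hB δ
  rw [← div_le_iff₀ hZ] at hfar
  refine le_trans (le_of_eq ?_) hfar
  rw [← Finset.sum_filter, hwsum]

/-- The threshold `(2 k + 1) log n / n` makes the exceptional mass of order `1 / n`. -/
lemma exceptional_mass_le {n k : ℕ} (hn : 0 < n) (c : ℝ) (hc : 0 ≤ c) :
    ((n : ℝ) + 1) ^ k * Real.exp (-(n * ((2 * k + 1) * Real.log n / n))) *
        ((Real.exp 1 * n) ^ k * c) ≤ (2 * Real.exp 1) ^ k * c / n := by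
  have hn' : (1 : ℝ) ≤ n := by exact_mod_cast hn
  have hn0 : (0 : ℝ) < n := by linarith
  -- Of these `2 k + 1` powers of `n`, `2 k` cancel the two polynomial factors and one remains.
  have hexp : Real.exp (-(n * ((2 * k + 1) * Real.log n / n))) = ((n : ℝ) ^ (2 * k + 1))⁻¹ := by
    rw [mul_div_cancel₀ _ hn0.ne', Real.exp_neg]
    congr 1
    have : (2 * (k : ℝ) + 1) * Real.log n = ((2 * k + 1 : ℕ) : ℝ) * Real.log n := by push_cast; ring
    rw [this, Real.exp_nat_mul, Real.exp_log hn0]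
  have h2 : ((n : ℝ) + 1) ^ k ≤ (2 * n) ^ k := by gcongr; linarith
  rw [hexp]
  calc ((n : ℝ) + 1) ^ k * ((n : ℝ) ^ (2 * k + 1))⁻¹ * ((Real.exp 1 * n) ^ k * c)
      ≤ (2 * n) ^ k * ((n : ℝ) ^ (2 * k + 1))⁻¹ * ((Real.exp 1 * n) ^ k * c) := by gcongr
    _ = (2 * Real.exp 1) ^ k * c / n := by
        rw [mul_pow, mul_pow, mul_pow, pow_succ, two_mul, pow_add]
        field_simp

lemma isLittleO_const_div (c : ℝ) :
    (fun n : ℕ => c / (n : ℝ)) =o[atTop] fun n : ℕ => (n : ℝ) ^ (-(1 / 2) : ℝ) := by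
  have hlim : Tendsto (fun n : ℕ => c * (n : ℝ) ^ (-(1 / 2) : ℝ)) atTop (nhds 0) := by
    simpa using ((tendsto_rpow_neg_atTop (by norm_num : (0 : ℝ) < 1 / 2)).comp
      tendsto_natCast_atTop_atTop).const_mul c
  have h := (isBigO_refl (fun n : ℕ => (n : ℝ) ^ (-(1 / 2) : ℝ)) atTop).mul_isLittleO
    ((isLittleO_one_iff ℝ).2 hlim)
  refine h.congr' ?_ (by simp)
  filter_upwards [eventually_gt_atTop 0] with n hn
  rw [mul_left_comm, ← Real.rpow_add (by exact_mod_cast hn),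
    show (-(1 / 2) + -(1 / 2) : ℝ) = -1 by norm_num, Real.rpow_neg_one, div_eq_mul_inv]

/-- The growth condition on `m` serves only to give `m ≤ n`: the square root is at most `n` once
`log n ≥ 1` and `n ≥ l`. -/
lemma eventually_le_of_isLittleO {m : ℕ → ℕ} {l : ℝ}
    (hm : (fun n => (m n : ℝ)) =o[atTop] fun n : ℕ => √(n * l / Real.log n)) :
    ∀ᶠ n in atTop, m n ≤ n := by
  filter_upwards [hm.bound zero_lt_one, eventually_ge_atTop 3,
    tendsto_natCast_atTop_atTop.eventually_ge_atTop (l : ℝ)] with n hn h3 hl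
  have h3' : (3 : ℝ) ≤ n := by exact_mod_cast h3
  rw [one_mul, Real.norm_of_nonneg (Nat.cast_nonneg _),
    Real.norm_of_nonneg (Real.sqrt_nonneg _)] at hn
  have hlog : 1 ≤ Real.log n := by
    rw [Real.le_log_iff_exp_le (by linarith)]
    linarith [Real.exp_one_lt_d9]
  have hle : √(n * l / Real.log n) ≤ n := by
    rw [Real.sqrt_le_left (by linarith), div_le_iff₀ (by linarith)]
    nlinarith [mul_le_mul_of_nonneg_left hl (by linarith : (0 : ℝ) ≤ n), sq_nonneg (n : ℝ)]
  exact_mod_cast hn.trans hle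

/-- Since `l * p ≤ 1`, inserting `l` in the denominator costs at most the factor `1 / √p`. -/
lemma leading_term_le {k n m : ℕ} {p l : ℝ} (hp : 0 < p) (hl : 0 < l) (hlp : l ≤ 1 / p) :
    m * (2 * k * √((2 * k + 1) * Real.log n / n)) ≤
      2 * k * √(2 * k + 1) / √p * m * √(Real.log n / (n * l)) := by
  have hsp : 0 < √p := Real.sqrt_pos.2 hp
  have hlog : 0 ≤ Real.log n / n := div_nonneg (Real.log_natCast_nonneg n) (Nat.cast_nonneg n)
  have h1 : √(Real.log n / n) ≤ √(Real.log n / (n * l)) / √p := by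
    rw [← Real.sqrt_div' _ hp.le]
    refine Real.sqrt_le_sqrt ?_
    rw [← div_div, div_div (Real.log n / n)]
    refine le_div_self hlog (by positivity) ?_
    rwa [le_div_iff₀ hp] at hlp
  rw [mul_div_assoc, Real.sqrt_mul (by positivity)]
  calc m * (2 * k * (√(2 * k + 1) * √(Real.log n / n)))
      ≤ m * (2 * k * (√(2 * k + 1) * (√(Real.log n / (n * l)) / √p))) := by gcongr
    _ = _ := by ring

end Main

end PredictiveCollapse

theorem theorem2 (k d : ℕ) (hk : 2 ≤ k) (p : ℝ) :
    ∃ C C' : ℝ, 0 < C ∧ 0 < C' ∧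
      ∀ (Q : Fin k → ℝ) (h : Fin k → Fin d → ℝ) (α : Fin d → ℝ) (P : Fin k → ℝ),
        Q ∈ openSimplex k →
        tangentSpace h ≠ ⊥ →
        IsInfoProjection Q (feasible h α) P →
        minMass P = p →
        P ∈ closure (⋃ n, feasibleTypes h α n) →
        ∀ (Ω : Type*) [MeasurableSpace Ω] (Pr : Measure Ω) [IsProbabilityMeasure Pr]
          (X : ℕ → Ω → Fin k), IsIIDSample Pr X Q →
        ∀ m : ℕ → ℕ,
          (fun n => (m n : ℝ)) =o[atTop]
            (fun n : ℕ => √(n * lambdaMin (projHessian h P) / Real.log n)) →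
          ∃ r : ℕ → ℝ, r =o[atTop] (fun n : ℕ => (n : ℝ) ^ (-(1 / 2) : ℝ)) ∧
            ∀ n : ℕ, (feasibleTypes h α n).Nonempty →
              tvDist (predictiveLaw Pr X h α n (m n)) (Measure.pi fun _ : Fin (m n) => law P) ≤
                C * m n * √(Real.log n / (n * lambdaMin (projHessian h P))) +
                C' * (m n : ℝ) ^ 2 / (n * p) + r n := by
  have hk0 : 0 < k := by omega
  rcases le_or_gt p 0 with hp | hp
  · refine ⟨1, 1, one_pos, one_pos, fun Q h α P _ _ hP hmin => ?_⟩
    exact absurd (hmin ▸ minMass_pos hk0 hP.1.1.1) hp.not_gt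
  have hkR : (0 : ℝ) < k := by exact_mod_cast hk0
  -- The first constant is `leading_term_le`'s; for the second, `p ≤ 1` gives `m ^ 2 / n ≤ m ^ 2 /
  -- (n p)`.
  refine ⟨2 * k * √(2 * k + 1) / √p, 1, by positivity, one_pos, ?_⟩
  intro Q h α P hQ hT hP hmin hcl Ω _ Pr _ X hX m hm
  have hPs : P ∈ openSimplex k := hP.1.1
  have hpP : ∀ a, p ≤ P a := fun a => hmin ▸ minMass_le P a
  have hp1 : p ≤ 1 := (hpP ⟨0, hk0⟩).trans (openSimplex_le_one hPs _)
  obtain ⟨hl1, hlp⟩ := lambdaMin_projHessian_bounds hPs (hmin ▸ hp) hT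
  rw [hmin] at hlp
  set l := lambdaMin (projHessian h P)
  obtain ⟨K, -, hK⟩ := exists_feasibleType_near hP.1 hcl
  obtain ⟨N, hN⟩ := eventually_atTop.1 (hK.and (eventually_le_of_isLittleO hm))
  set c := (2 * Real.exp 1) ^ k * Real.exp (k * K ^ 2 / p)
  have hc : 0 < c := by positivity
  -- The finitely many small `n` take the trivial bound one; `N + 1` rather than `N` also excludes
  -- `n = 0`. The remainder may depend on `K`, unlike the two constants.
  refine ⟨fun n => if n < N + 1 then 1 else c / n, ?_, fun n hne => ?_⟩
  · refine (isLittleO_const_div c).congr' ?_ EventuallyEq.rfl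
    filter_upwards [eventually_ge_atTop (N + 1)] with n hn
    rw [if_neg (not_lt.2 hn)]
  have hlead := leading_term_le (k := k) (n := n) (m := m n) hp (by linarith) hlp
  have hlead0 : 0 ≤ 2 * k * √(2 * k + 1) / √p * m n * √(Real.log n / (n * l)) := by positivity
  have hquad0 : 0 ≤ 1 * (m n : ℝ) ^ 2 / (n * p) := by positivity
  dsimp only
  split_ifs with hn
  · have := tvDist_predictiveLaw_le_one (Pr := Pr) (h := h) (α := α) hPs hX.1 n (m n)
    linarith
  · have hn0 : 0 < n := by omega
    obtain ⟨hnear, hmn⟩ := hN n (by omega)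
    obtain ⟨x₀, hx₀, hx₀P⟩ := hnear hne
    have hmain := tvDist_predictiveLaw_le hQ hP hX hn0 hmn hp hpP hx₀ hx₀P
      ((2 * k + 1) * Real.log n / n)
    have hexc := exceptional_mass_le (k := k) hn0 (Real.exp (k * K ^ 2 / p)) (Real.exp_pos _).le
    have hquad : (m n : ℝ) ^ 2 / n ≤ 1 * (m n : ℝ) ^ 2 / (n * p) := by
      rw [one_mul, ← div_div]
      exact le_div_self (by positivity) hp hp1
    linarith
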